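/- Let $\mathbb{N}=\{1,2,\dots\}$ and identify $\mathbb{R}^n$ with the set of $u\in\mathbb{R}^{\mathbb{N}}$ such that $u_i=0$ for all $i>n$; put $\mathbb{Z}^n=\mathbb{R}^n\cap\mathbb{Z}^{\mathbb{N}}$. Let $\mathrm{Sym}(n)$ be the group of permutations of $\mathbb{N}$ fixing every $i>n$, acting on $\mathbb{R}^{\mathbb{N}}$ by $\sigma(u)=(u_{\sigma^{-1}(i)})_{i\ge 1}$, and put $\mathrm{Sym}(n)(A)=\{\sigma(u)\mid \sigma\in\mathrm{Sym}(n),\,u\in A\}$. For a set $A$ of vectors, let $\mathrm{cn}(A)$ be the set of all finite linear combinations of elements of $A$ with coefficients in $\mathbb{R}_{\ge0}$, and let $\mathrm{mn}(A)$ be the set of those with coefficients in $\mathbb{Z}_{\ge0}$. A cone is a set $C$ with $C=\mathrm{cn}(C)$. It is finitely generated if $C=\mathrm{cn}(A)$ for some finite set $A$, and rational if $C=\mathrm{cn}(A)$ for some set $A$ of vectors with rational coordinates. A monoid $M\subseteq\mathbb{Z}^n$ is a set with $M=\mathrm{mn}(M)$. It is finitely generated if $M=\mathrm{mn}(A)$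 for some finite set $A$, and normal if $M=\{u\in\mathbb{Z}^{\mathbb{N}}\mid ku\in M\text{ for some integer }k\ge1\}$. A chain $(C_n)_{n\ge1}$ of cones $C_n\subseteq\mathbb{R}^n$ is $\mathrm{Sym}$-invariant if $\mathrm{cn}(\mathrm{Sym}(n)(C_m))\subseteq C_n$ for all $n\ge m\ge1$. A $\mathrm{Sym}$-invariant chain is stabilizing if there is an integer $r\ge1$ such that $C_n=\mathrm{cn}(\mathrm{Sym}(n)(C_m))$ for all $n\ge m\ge r$. The same notions for chains $(M_n)_{n\ge1}$ of monoids $M_n\subseteq\mathbb{Z}^n$ are defined with $\mathrm{mn}$ in place of $\mathrm{cn}$. **Corollary.** Let $(C_n)_{n\ge1}$ be a stabilizing $\mathrm{Sym}$-invariant chain of finitely generated rational cones with $C_n\subseteq\mathbb{R}^n_{\ge0}$ for all $n\ge1$. Then $(M_n)_{n\ge1}$ with $M_n=C_n\cap\mathbb{Z}^n$ for $n\ge1$ is a stabilizing $\mathrm{Sym}$-invariant chain of finitely generated normal monoids. -/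

import Mathlib

namespace SymGordan

/-- The coordinates are indexed by `ℕ = {0, 1, 2, …}`, so that `[n]` is `{0, …, n - 1}`.
`coordSubspace R n` is `R^n`, regarded as the set of those `u` in `R^ℕ` whose coordinates outside
of `[n]` vanish. -/
def coordSubspace (R : Type*) [Zero R] (n : ℕ) : Set (ℕ → R) :=
  {u | ∀ i, n ≤ i → u i = 0}

/-- `Sym(n)`, as the subgroup of the permutations of `ℕ` that fix everything outside of `[n]`. -/
def symGroup (n : ℕ) : Subgroup (Equiv.Perm ℕ) where
  carrier := {σ | ∀ i, n ≤ i → σ i = i}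
  mul_mem' := by
    intro a b ha hb i hi
    rw [Equiv.Perm.mul_apply, hb i hi, ha i hi]
  one_mem' := fun _ _ => rfl
  inv_mem' := by
    intro a ha i hi
    rw [Equiv.Perm.inv_eq_iff_eq, ha i hi]

/-- The action of permutations on sequences: `σ(u) = (u_{σ⁻¹(i)})_i`. -/
def permAct {R : Type*} (σ : Equiv.Perm ℕ) (u : ℕ → R) : ℕ → R :=
  fun i => u (σ⁻¹ i)

/-- `Sym(n)(A) = {σ(u) | σ ∈ Sym(n), u ∈ A}`. -/
def symOrbit {R : Type*} (n : ℕ) (A : Set (ℕ → R)) : Set (ℕ → R) :=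
  {v | ∃ σ ∈ symGroup n, ∃ u ∈ A, v = permAct σ u}

/-- A `Sym`-invariant chain `(C_n)_{n ≥ 1}` of cones `C_n ⊆ ℝ^n`
(the value of `C` at `0` is irrelevant). -/
structure IsSymInvariantConeChain (C : ℕ → PointedCone ℝ (ℕ → ℝ)) : Prop where
  subset_coord : ∀ n, 1 ≤ n → (C n : Set (ℕ → ℝ)) ⊆ coordSubspace ℝ n
  invariant : ∀ m n, 1 ≤ m → m ≤ n →
    PointedCone.hull ℝ (symOrbit n (C m : Set (ℕ → ℝ))) ≤ C n

/-- The chain of cones stabilizes: `C_n = cn(Sym(n)(C_m))` for all `n ≥ m ≥ r`, for some `r ≥ 1`. -/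
def ConeChainStabilizes (C : ℕ → PointedCone ℝ (ℕ → ℝ)) : Prop :=
  ∃ r, 1 ≤ r ∧ ∀ m n, r ≤ m → m ≤ n →
    C n = PointedCone.hull ℝ (symOrbit n (C m : Set (ℕ → ℝ)))

/-- A cone is rational if it is generated by elements with rational coordinates. -/
def IsRationalCone (C : PointedCone ℝ (ℕ → ℝ)) : Prop :=
  ∃ A : Set (ℕ → ℝ), (∀ a ∈ A, ∀ i, ∃ q : ℚ, a i = (q : ℝ)) ∧ C = PointedCone.hull ℝ A

/-- A `Sym`-invariant chain `(M_n)_{n ≥ 1}` of monoids `M_n ⊆ ℤ^n`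
(the value of `M` at `0` is irrelevant). -/
structure IsSymInvariantMonoidChain (M : ℕ → AddSubmonoid (ℕ → ℤ)) : Prop where
  subset_coord : ∀ n, 1 ≤ n → (M n : Set (ℕ → ℤ)) ⊆ coordSubspace ℤ n
  invariant : ∀ m n, 1 ≤ m → m ≤ n →
    AddSubmonoid.closure (symOrbit n (M m : Set (ℕ → ℤ))) ≤ M n

/-- The chain of monoids stabilizes: `M_n = mn(Sym(n)(M_m))` for all `n ≥ m ≥ r`,
for some `r ≥ 1`. -/
def MonoidChainStabilizes (M : ℕ → AddSubmonoid (ℕ → ℤ)) : Prop :=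
  ∃ r, 1 ≤ r ∧ ∀ m n, r ≤ m → m ≤ n →
    M n = AddSubmonoid.closure (symOrbit n (M m : Set (ℕ → ℤ)))

/-- The normalization `{u | k u ∈ M for some integer k ≥ 1}` of a monoid `M` of integer
sequences. -/
def normalization (M : AddSubmonoid (ℕ → ℤ)) : Set (ℕ → ℤ) :=
  {u | ∃ k : ℕ, 1 ≤ k ∧ k • u ∈ M}

/-- A monoid of integer sequences is normal if it equals its normalization. -/
def IsNormalMonoid (M : AddSubmonoid (ℕ → ℤ)) : Prop :=
  (M : Set (ℕ → ℤ)) = normalization M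

/-- The monoid `C ∩ ℤ^n`. -/
def latticePoints (n : ℕ) (C : PointedCone ℝ (ℕ → ℝ)) : AddSubmonoid (ℕ → ℤ) where
  carrier := {u | u ∈ coordSubspace ℤ n ∧ (fun i => (u i : ℝ)) ∈ C}
  zero_mem' := by
    refine ⟨fun _ _ => rfl, ?_⟩
    have h : (fun i => (((0 : ℕ → ℤ) i : ℤ) : ℝ)) = 0 := by
      funext i
      simp
    rw [h]
    exact C.zero_mem
  add_mem' := by
    rintro a b ⟨ha, ha'⟩ ⟨hb, hb'⟩
    refine ⟨fun i hi => ?_, ?_⟩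
    · rw [Pi.add_apply, ha i hi, hb i hi, add_zero]
    · have h : (fun i => (((a + b) i : ℤ) : ℝ)) =
          (fun i => (a i : ℝ)) + (fun i => (b i : ℝ)) := by
        funext i
        simp
      rw [h]
      exact C.add_mem ha' hb'

end SymGordan

namespace SymGordan

open Finset

/-! Invariance is inherited from the cones, normality holds because cones are closed under division
by positive integers, and finite generation is Gordan's lemma. The substance is stabilization, which
follows from a bound, uniform in `n`, on the coordinate sums of generators of `M_n`.

Take integer generators of `C_r` with coordinate sums at most `K`; their orbits generate `C_n`. If
an integer point `u` of `C_n` has at least `7 * K + 3` positive coordinates, with `u i` smallest and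
`u l` second smallest, then `u - e_i + e_l` stays in `C_n` (`sub_single_add_single_mem`). Such moves
keep the coordinate sum and increase the sum of squares, so they end at a point of small support.
That point can be permuted into a fixed `C_R`, because `C_n ∩ ℝ^R = C_R`
(`mem_of_mem_coordSubspace`), and there Gordan's lemma gives generators of sum at most some `K'`.

The moves can be undone within the monoid generated by points of sum at most `K'`: the balancing
move on a sum can be made on one summand, where it is a convex combination of the summand and its
swap (`transfer_mem_closure`). So these points generate `M_n` for all `n ≥ R`, and their supports
have size at most `K'`. -/

/-! ### Permutations acting on finitely supported sequences -/

theorem perm_inv_apply_self (σ : Equiv.Perm ℕ) (i : ℕ) : σ⁻¹ (σ i) = i :=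
  σ.symm_apply_apply i

theorem perm_apply_inv_self (σ : Equiv.Perm ℕ) (i : ℕ) : σ (σ⁻¹ i) = i :=
  σ.apply_symm_apply i

theorem permAct_add {R : Type*} [Add R] (σ : Equiv.Perm ℕ) (u v : ℕ → R) :
    permAct σ (u + v) = permAct σ u + permAct σ v := rfl

theorem permAct_mul {R : Type*} (σ τ : Equiv.Perm ℕ) (u : ℕ → R) :
    permAct (σ * τ) u = permAct σ (permAct τ u) := by
  funext i
  simp [permAct]

theorem permAct_inv_permAct {R : Type*} (σ : Equiv.Perm ℕ) (u : ℕ → R) :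
    permAct σ⁻¹ (permAct σ u) = u := by
  rw [← permAct_mul, inv_mul_cancel]
  rfl

theorem permAct_mem_coordSubspace {R : Type*} [Zero R] {n : ℕ} {σ : Equiv.Perm ℕ}
    (hσ : σ ∈ symGroup n) {u : ℕ → R} (hu : u ∈ coordSubspace R n) :
    permAct σ u ∈ coordSubspace R n := by
  intro i hi
  have h : σ⁻¹ i = i := (symGroup n).inv_mem hσ i hi
  rw [permAct, h]
  exact hu i hi

theorem coordSubspace_mono {R : Type*} [Zero R] {m n : ℕ} (h : m ≤ n) :
    coordSubspace R m ⊆ coordSubspace R n := fun _ hu i hi => hu i (h.trans hi)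

theorem symGroup_apply_lt {n : ℕ} {σ : Equiv.Perm ℕ} (hσ : σ ∈ symGroup n) {i : ℕ} (hi : i < n) :
    σ i < n := by
  by_contra! h
  have h1 : σ⁻¹ (σ i) = σ i := (symGroup n).inv_mem hσ _ h
  rw [perm_inv_apply_self] at h1
  omega

theorem swap_mem_symGroup {n i j : ℕ} (hi : i < n) (hj : j < n) :
    Equiv.swap i j ∈ symGroup n := fun k hk =>
  Equiv.swap_apply_of_ne_of_ne (by omega) (by omega)

/-- An injection between subsets of `[n]` extends to an element of `Sym(n)`. -/
theorem exists_symGroup_of_injOn {n : ℕ} (S : Finset ℕ) (f : ℕ → ℕ) (hS : ∀ s ∈ S, s < n)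
    (hf : ∀ s ∈ S, f s < n) (hinj : Set.InjOn f S) :
    ∃ σ ∈ symGroup n, ∀ s ∈ S, σ s = f s := by
  induction S using Finset.induction_on with
  | empty => exact ⟨1, one_mem _, by simp⟩
  | insert a S ha ih =>
    obtain ⟨σ, hσ, h⟩ := ih (fun s hs => hS s (mem_insert_of_mem hs))
      (fun s hs => hf s (mem_insert_of_mem hs)) (hinj.mono (by simp))
    refine ⟨Equiv.swap (σ a) (f a) * σ, mul_mem (swap_mem_symGroup
      (symGroup_apply_lt hσ (hS a (mem_insert_self a S))) (hf a (mem_insert_self a S))) hσ, ?_⟩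
    intro s hs
    rcases mem_insert.1 hs with rfl | hs'
    · simp
    · have hne : s ≠ a := fun h => ha (h ▸ hs')
      rw [Equiv.Perm.mul_apply, Equiv.swap_apply_of_ne_of_ne, h s hs']
      · exact fun h => hne (σ.injective h)
      · rw [h s hs']
        exact fun h => hne (hinj (by simp [hs']) (by simp) h)

/-- A sequence supported on `[n]` with at most `m` nonzero entries can be moved into `[m]`. -/
theorem exists_permAct_mem_coordSubspace {R : Type*} [Zero R] {m n : ℕ} (hmn : m ≤ n) {u : ℕ → R}
    (hu : u ∈ coordSubspace R n) {S : Finset ℕ} (hS : ∀ i, u i ≠ 0 → i ∈ S) (hcard : #S ≤ m) :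
    ∃ σ ∈ symGroup n, permAct σ u ∈ coordSubspace R m := by
  classical
  set S' := {i ∈ S | u i ≠ 0} with hS'
  have hcard' : #S' ≤ #(range m) := by
    rw [card_range]
    exact (card_filter_le _ _).trans hcard
  have hlt : ∀ i, u i ≠ 0 → i < n := fun i hi => by
    by_contra! h
    exact hi (hu i h)
  obtain ⟨f, hf, hinj⟩ : ∃ f : ℕ → ℕ, (∀ s ∈ S', f s ∈ range m) ∧ Set.InjOn f S' := by
    obtain ⟨f, hf, hinj⟩ := S'.finite_toSet.exists_injOn_of_encard_le (t := (range m : Set ℕ))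
      (by simpa only [Set.encard_coe_eq_coe_finsetCard, Nat.cast_le] using hcard')
    exact ⟨f, fun s hs => hf hs, hinj⟩
  obtain ⟨σ, hσ, h⟩ := exists_symGroup_of_injOn (n := n) S' f
    (fun s hs => hlt s (mem_filter.1 hs).2)
    (fun s hs => (mem_range.1 (hf s hs)).trans_le hmn) hinj
  refine ⟨σ, hσ, fun i hi => ?_⟩
  by_contra h0
  have h1 : σ⁻¹ i ∈ S' := mem_filter.2 ⟨hS _ h0, h0⟩
  have h2 := h _ h1
  rw [perm_apply_inv_self] at h2
  have := mem_range.1 (hf _ h1)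
  omega

/-- Two sequences supported on `[m]` in the same orbit are conjugate under `Sym(m)`. -/
theorem exists_symGroup_permAct_eq {R : Type*} [Zero R] {m : ℕ} {u : ℕ → R} (σ : Equiv.Perm ℕ)
    (hu : u ∈ coordSubspace R m) (hσu : permAct σ u ∈ coordSubspace R m) :
    ∃ τ ∈ symGroup m, permAct τ u = permAct σ u := by
  classical
  have hlt : ∀ i, u i ≠ 0 → i < m := fun i hi => by
    by_contra! h
    exact hi (hu i h)
  have hlt' : ∀ i, u i ≠ 0 → σ i < m := fun i hi => by
    by_contra! h
    have := hσu _ h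
    simp only [permAct, perm_inv_apply_self] at this
    exact hi this
  -- Only the values of `σ` on the support of `u` matter, and there it maps `[m]` into `[m]`.
  obtain ⟨τ, hτ, h⟩ := exists_symGroup_of_injOn (n := m) {i ∈ range m | u i ≠ 0} σ
    (fun s hs => hlt s (mem_filter.1 hs).2) (fun s hs => hlt' s (mem_filter.1 hs).2)
    σ.injective.injOn
  have h' : ∀ i, u i ≠ 0 → τ i = σ i := fun i hi =>
    h i (mem_filter.2 ⟨mem_range.2 (hlt i hi), hi⟩)
  refine ⟨τ, hτ, ?_⟩
  funext i
  simp only [permAct]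
  by_cases h1 : u (τ⁻¹ i) = 0
  · by_cases h2 : u (σ⁻¹ i) = 0
    · rw [h1, h2]
    · have := h' _ h2
      rw [perm_apply_inv_self, ← Equiv.Perm.eq_inv_iff_eq] at this
      rw [← this]
  · have := h' _ h1
    rw [perm_apply_inv_self, eq_comm, ← Equiv.Perm.eq_inv_iff_eq] at this
    rw [this]

/-! ### Conic combinations and intersections with coordinate subspaces -/

/-- Members of the conic hull are finite nonnegative combinations. -/
theorem exists_sum_of_mem_hull {S : Set (ℕ → ℝ)} {u : ℕ → ℝ} (hu : u ∈ PointedCone.hull ℝ S) :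
    ∃ (N : ℕ) (c : Fin N → ℝ) (b : Fin N → ℕ → ℝ), (∀ k, 0 ≤ c k) ∧ (∀ k, b k ∈ S) ∧
      u = ∑ k, c k • b k := by
  obtain ⟨N, f, g, h⟩ := Submodule.mem_span_set'.1 hu
  exact ⟨N, fun k => (f k : ℝ), fun k => (g k : ℕ → ℝ), fun k => (f k).2, fun k => (g k).2, h.symm⟩

theorem sum_smul_mem {ι : Type*} {s : Finset ι} {C : PointedCone ℝ (ℕ → ℝ)} {c : ι → ℝ}
    {b : ι → ℕ → ℝ} (hc : ∀ k ∈ s, 0 ≤ c k) (hb : ∀ k ∈ s, b k ∈ C) :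
    ∑ k ∈ s, c k • b k ∈ C :=
  sum_mem fun k hk => C.smul_mem (hc k hk) (hb k hk)

section Chain

variable {C : ℕ → PointedCone ℝ (ℕ → ℝ)}

theorem IsSymInvariantConeChain.permAct_mem (hchain : IsSymInvariantConeChain C) {m n : ℕ}
    (hm : 1 ≤ m) (hmn : m ≤ n) {σ : Equiv.Perm ℕ} (hσ : σ ∈ symGroup n) {u : ℕ → ℝ}
    (hu : u ∈ C m) : permAct σ u ∈ C n :=
  hchain.invariant m n hm hmn (PointedCone.subset_hull ⟨σ, hσ, u, hu, rfl⟩)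

/-- In a stabilizing chain of nonnegative cones, `C_n ∩ ℝ^m = C_m`. -/
theorem mem_of_mem_coordSubspace (hchain : IsSymInvariantConeChain C)
    (hnonneg : ∀ n, 1 ≤ n → ∀ u ∈ C n, ∀ i, 0 ≤ u i) {r m n : ℕ} (hr : 1 ≤ r) (hrm : r ≤ m)
    (hmn : m ≤ n) (hn : C n = PointedCone.hull ℝ (symOrbit n (C r : Set (ℕ → ℝ)))) {w : ℕ → ℝ}
    (hw : w ∈ C n) (hwm : w ∈ coordSubspace ℝ m) : w ∈ C m := by
  have hw' := hw
  rw [hn] at hw'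
  obtain ⟨N, c, b, hc, hb, rfl⟩ := exists_sum_of_mem_hull hw'
  have hbn : ∀ k, b k ∈ C n := fun k => by
    rw [hn]
    exact PointedCone.subset_hull (hb k)
  refine sum_mem fun k _ => ?_
  rcases (hc k).eq_or_lt with h0 | h0
  · rw [← h0, zero_smul]
    exact zero_mem _
  refine (C m).smul_mem (hc k) ?_
  obtain ⟨σ, hσ, a, ha, hab⟩ := hb k
  have har : a ∈ coordSubspace ℝ m :=
    coordSubspace_mono hrm (hchain.subset_coord r hr ha)
  -- A vanishing sum of nonnegative terms forces every term to vanish, so generators used with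
  -- positive weight lie in `ℝ^m` themselves.
  have hbm : b k ∈ coordSubspace ℝ m := by
    intro i hi
    have h1 := hwm i hi
    rw [Finset.sum_apply, Finset.sum_eq_zero_iff_of_nonneg] at h1
    · have h2 := h1 k (mem_univ k)
      simp only [Pi.smul_apply, smul_eq_mul, mul_eq_zero] at h2
      exact h2.resolve_left h0.ne'
    · intro j _
      exact mul_nonneg (hc j) (hnonneg n (by omega) _ (hbn j) i)
  rw [hab] at hbm ⊢
  obtain ⟨τ, hτ, h⟩ := exists_symGroup_permAct_eq σ har hbm
  rw [← h]
  exact hchain.permAct_mem hr hrm hτ ha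

end Chain

/-! ### Integer points: normality and Gordan's lemma -/

/-- The real sequence underlying an integer sequence. -/
def toReal (u : ℕ → ℤ) : ℕ → ℝ := fun i => (u i : ℝ)

theorem toReal_sub (u v : ℕ → ℤ) : toReal (u - v) = toReal u - toReal v := by
  funext i
  simp [toReal]

theorem toReal_nsmul (k : ℕ) (u : ℕ → ℤ) : toReal (k • u) = (k : ℝ) • toReal u := by
  funext i
  simp [toReal]

theorem isNormalMonoid_latticePoints (n : ℕ) (C : PointedCone ℝ (ℕ → ℝ)) :
    IsNormalMonoid (latticePoints n C) := by
  ext u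
  constructor
  · intro hu
    exact ⟨1, le_rfl, by simpa using hu⟩
  · rintro ⟨k, hk, hu, hu'⟩
    have hk0 : (k : ℝ) ≠ 0 := by
      have : k ≠ 0 := by omega
      exact_mod_cast this
    refine ⟨fun i hi => ?_, ?_⟩
    · have h := hu i hi
      simp only [Pi.smul_apply, nsmul_eq_mul, mul_eq_zero] at h
      rcases h with h | h
      · simp at h
        omega
      · exact h
    · change toReal (k • u) ∈ C at hu'
      rw [toReal_nsmul] at hu'
      have h := C.smul_mem (r := (k : ℝ)⁻¹) (by positivity) hu'
      rwa [inv_smul_smul₀ hk0] at h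

/-- A rational sequence with finitely many nonzero entries has an integral positive multiple. -/
theorem exists_integral_multiple {n : ℕ} {a : ℕ → ℝ} (ha : a ∈ coordSubspace ℝ n)
    (hq : ∀ i, ∃ q : ℚ, a i = (q : ℝ)) :
    ∃ d : ℕ, 1 ≤ d ∧ ∃ z : ℕ → ℤ, toReal z = (d : ℝ) • a := by
  choose q hq using hq
  have hpos : 1 ≤ ∏ i ∈ range n, (q i).den :=
    Nat.one_le_iff_ne_zero.2 (prod_ne_zero_iff.2 fun i _ => (q i).den_nz)
  refine ⟨∏ i ∈ range n, (q i).den, hpos, ?_⟩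
  have h : ∀ i, ∃ z : ℤ, (z : ℝ) = ((∏ j ∈ range n, (q j).den : ℕ) : ℝ) * a i := by
    intro i
    by_cases hi : i < n
    · obtain ⟨t, ht⟩ := dvd_prod_of_mem (fun j => (q j).den) (mem_range.2 hi)
      refine ⟨t * (q i).num, ?_⟩
      rw [ht, hq i]
      have h1 : ((q i).den : ℚ) * q i = (q i).num := Rat.den_mul_eq_num (q i)
      have h2 : ((q i).den : ℝ) * (q i : ℝ) = ((q i).num : ℝ) := by exact_mod_cast h1
      push_cast
      rw [← h2]
      ring
    · exact ⟨0, by simp [ha i (by omega)]⟩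
  choose z hz using h
  exact ⟨z, funext fun i => hz i⟩

/-- A finitely generated rational cone in `ℝ^n` is generated by finitely many integer vectors. -/
theorem exists_integral_generators {n : ℕ} {C : PointedCone ℝ (ℕ → ℝ)}
    (hsub : (C : Set (ℕ → ℝ)) ⊆ coordSubspace ℝ n) (hfg : C.FG) (hrat : IsRationalCone C) :
    ∃ A : Finset (ℕ → ℤ), C = PointedCone.hull ℝ (toReal '' A) := by
  classical
  obtain ⟨S, hS, rfl⟩ := hrat
  obtain ⟨T, hTS, hT⟩ := (Submodule.fg_span_iff_fg_span_finset_subset S).1 hfg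
  have hT' : PointedCone.hull ℝ S = PointedCone.hull ℝ (T : Set (ℕ → ℝ)) := hT
  have hex : ∀ a : ℕ → ℝ, ∃ z : ℕ → ℤ, a ∈ T → ∃ d : ℕ, 1 ≤ d ∧ toReal z = (d : ℝ) • a := by
    intro a
    by_cases ha : a ∈ T
    · obtain ⟨d, hd, z, hz⟩ := exists_integral_multiple
        (hsub (PointedCone.subset_hull (hTS ha))) (hS a (hTS ha))
      exact ⟨z, fun _ => ⟨d, hd, hz⟩⟩
    · exact ⟨0, fun h => absurd h ha⟩
  choose z hz using hex
  refine ⟨T.image z, le_antisymm ?_ ?_⟩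
  · rw [hT']
    refine Submodule.span_le.2 fun a ha => ?_
    obtain ⟨d, hd, h⟩ := hz a ha
    have hd0 : (d : ℝ) ≠ 0 := by
      have : d ≠ 0 := by omega
      exact_mod_cast this
    have h1 : toReal (z a) ∈ PointedCone.hull ℝ (toReal '' (T.image z : Set (ℕ → ℤ))) :=
      PointedCone.subset_hull ⟨z a, by simpa using ⟨a, ha, rfl⟩, rfl⟩
    rw [h] at h1
    have h2 := PointedCone.smul_mem _ (r := (d : ℝ)⁻¹) (by positivity) h1
    rwa [inv_smul_smul₀ hd0] at h2
  · refine Submodule.span_le.2 ?_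
    rintro _ ⟨w, hw, rfl⟩
    obtain ⟨a, ha, rfl⟩ := by simpa using hw
    obtain ⟨d, hd, h⟩ := hz a ha
    rw [h]
    exact PointedCone.smul_mem _ (by positivity) (PointedCone.subset_hull (hTS ha))

theorem finite_integer_box (n : ℕ) (B : ℕ → ℤ) :
    {w : ℕ → ℤ | w ∈ coordSubspace ℤ n ∧ ∀ i, 0 ≤ w i ∧ w i ≤ B i}.Finite := by
  have hfin : (Set.pi Set.univ fun i : Fin n => Set.Icc (0 : ℤ) (B i)).Finite :=
    Set.Finite.pi fun i => Set.finite_Icc _ _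
  refine Set.Finite.of_finite_image (f := fun w (i : Fin n) => w i) (hfin.subset ?_) ?_
  · rintro _ ⟨w, hw, rfl⟩ i _
    exact hw.2 i
  · intro v hv w hw h
    funext i
    by_cases hi : i < n
    · exact congrFun h ⟨i, hi⟩
    · rw [hv.1 i (by omega), hw.1 i (by omega)]

/-- **Gordan's lemma** for finitely generated rational cones in the nonnegative orthant. -/
theorem fg_latticePoints {n : ℕ} {C : PointedCone ℝ (ℕ → ℝ)}
    (hsub : (C : Set (ℕ → ℝ)) ⊆ coordSubspace ℝ n) (hfg : C.FG) (hrat : IsRationalCone C)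
    (hnonneg : ∀ u ∈ C, ∀ i, 0 ≤ u i) : (latticePoints n C).FG := by
  obtain ⟨A, hA⟩ := exists_integral_generators hsub hfg hrat
  have hAC : ∀ a ∈ A, toReal a ∈ C := fun a ha => by
    rw [hA]
    exact PointedCone.subset_hull ⟨a, ha, rfl⟩
  have hAM : ∀ a ∈ A, a ∈ latticePoints n C := fun a ha =>
    ⟨fun i hi => Int.cast_eq_zero.1 (hsub (hAC a ha) i hi : (a i : ℝ) = 0), hAC a ha⟩
  have hMnonneg : ∀ w ∈ latticePoints n C, ∀ i, 0 ≤ w i := fun w hw i => by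
    exact_mod_cast hnonneg _ hw.2 i
  -- Coefficients in `[0, 1]` on the nonnegative generators give a point below their sum, so `B`
  -- bounds every remainder left after taking floors.
  set B : ℕ → ℤ := ∑ a ∈ A, a with hB
  set T := {w | w ∈ latticePoints n C ∧ ∀ i, w i ≤ B i} with hT
  have hTfin : T.Finite := (finite_integer_box n B).subset fun w hw =>
    ⟨hw.1.1, fun i => ⟨hMnonneg w hw.1 i, hw.2 i⟩⟩
  have hAT : ∀ a ∈ A, a ∈ T := fun a ha => ⟨hAM a ha, fun i => by
    rw [hB, Finset.sum_apply]
    exact single_le_sum (f := fun a : ℕ → ℤ => a i) (fun b hb => hMnonneg b (hAM b hb) i) ha⟩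
  refine (AddSubmonoid.fg_iff _).2 ⟨T, le_antisymm ?_ ?_, hTfin⟩
  · exact AddSubmonoid.closure_le.2 fun w hw => hw.1
  intro u hu
  have hu' : toReal u ∈ PointedCone.hull ℝ (toReal '' (A : Set (ℕ → ℤ))) := hA ▸ hu.2
  obtain ⟨c, hc⟩ := (Submodule.mem_span_image_finset_iff_exists_fun' _).1 hu'
  set z : ℕ → ℤ := ∑ a ∈ A, ⌊c a⌋₊ • a with hz
  have hreal : toReal (u - z) = ∑ a ∈ A, ((c a : ℝ) - ⌊c a⌋₊) • toReal a := by
    funext i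
    have h := congrFun hc i
    simp only [Finset.sum_apply, Pi.smul_apply] at h
    have h' : toReal u i = ∑ a ∈ A, (c a : ℝ) * (a i : ℝ) := h.symm
    rw [toReal_sub, Pi.sub_apply, h', hz, Finset.sum_apply]
    simp only [toReal, Finset.sum_apply, Pi.smul_apply, smul_eq_mul, Int.cast_sum, sub_mul,
      sum_sub_distrib]
    simp
  have hfrac0 : ∀ a, 0 ≤ (c a : ℝ) - ⌊c a⌋₊ := fun a =>
    sub_nonneg.2 (by exact_mod_cast Nat.floor_le (c a).2)
  have hfrac1 : ∀ a, (c a : ℝ) - ⌊c a⌋₊ ≤ 1 := fun a => by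
    have := (Nat.lt_floor_add_one (c a)).le
    have h : (c a : ℝ) ≤ ⌊c a⌋₊ + 1 := by exact_mod_cast this
    linarith
  have hzM : z ∈ latticePoints n C := sum_mem fun a ha => nsmul_mem (hAM a ha) _
  have hrem : u - z ∈ T := by
    refine ⟨⟨fun i hi => ?_, ?_⟩, fun i => ?_⟩
    · rw [Pi.sub_apply, hu.1 i hi, hzM.1 i hi, sub_zero]
    · change toReal (u - z) ∈ C
      rw [hreal]
      exact sum_smul_mem (fun a _ => hfrac0 a) hAC
    · have h := congrFun hreal i
      have h1 : (((u - z) i : ℤ) : ℝ) ≤ (B i : ℝ) := by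
        change toReal (u - z) i ≤ _
        rw [h, hB]
        simp only [Finset.sum_apply, Pi.smul_apply, smul_eq_mul, Int.cast_sum]
        refine sum_le_sum fun a ha => mul_le_of_le_one_left ?_ (hfrac1 a)
        exact hnonneg _ (hAC a ha) i
      exact_mod_cast h1
  rw [← add_sub_cancel z u]
  refine add_mem (sum_mem fun a ha => nsmul_mem (AddSubmonoid.subset_closure (hAT a ha)) _)
    (AddSubmonoid.subset_closure hrem)

/-! ### Balancing transfers inside the monoid -/

/-- For a symmetric cone, the monoid generated by the lattice points of coordinate sum at most `K` is
closed under moving a unit from a coordinate to a smaller one. -/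
theorem transfer_mem_closure {n K : ℕ} {C : PointedCone ℝ (ℕ → ℝ)}
    (hperm : ∀ σ ∈ symGroup n, ∀ u ∈ C, permAct σ u ∈ C) {i l : ℕ} (hi : i < n) (hl : l < n)
    {v : ℕ → ℤ}
    (hv : v ∈ AddSubmonoid.closure {w | w ∈ latticePoints n C ∧ ∑ j ∈ range n, w j ≤ K})
    (hlt : v i < v l) :
    v - Pi.single l 1 + Pi.single i 1 ∈
      AddSubmonoid.closure {w | w ∈ latticePoints n C ∧ ∑ j ∈ range n, w j ≤ K} := by
  induction hv using AddSubmonoid.closure_induction with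
  | zero => simp at hlt
  | add x y hx hy ihx ihy =>
    -- One of the two summands has its `i` entry below its `l` entry; the transfer is made there.
    rcases lt_or_ge (x i) (x l) with h | h
    · have := add_mem (ihx h) hy
      convert this using 1
      abel
    · have h' : y i < y l := by
        simp only [Pi.add_apply] at hlt
        omega
      have := add_mem hx (ihy h')
      convert this using 1
      abel
  | mem w hw =>
    refine AddSubmonoid.subset_closure ⟨⟨fun j hj => ?_, ?_⟩, ?_⟩
    · have h1 : j ≠ l := by omega
      have h2 : j ≠ i := by omega
      simp [h1, h2, hw.1.1 j hj]
    · have hil : i ≠ l := by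
        rintro rfl
        exact lt_irrefl _ hlt
      have hd : (0 : ℝ) < w l - w i := by
        have : (w i : ℝ) < w l := by exact_mod_cast hlt
        linarith
      have hd1 : (1 : ℝ) ≤ w l - w i := by
        have : ((1 : ℤ) : ℝ) ≤ ((w l - w i : ℤ) : ℝ) := by exact_mod_cast (by omega)
        simpa using this
      have hwC : toReal w ∈ C := hw.1.2
      have hsw := hperm _ (swap_mem_symGroup hl hi) _ hwC
      -- The swap moves `w l - w i` units from `l` to `i`, so weight `1 / (w l - w i)` on it moves
      -- exactly one. Integrality makes this weight at most `1`.
      have key : toReal (w - Pi.single l 1 + Pi.single i 1) =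
          (1 - ((w l : ℝ) - w i)⁻¹) • toReal w +
            ((w l : ℝ) - w i)⁻¹ • permAct (Equiv.swap l i) (toReal w) := by
        funext j
        simp only [toReal, permAct, Equiv.swap_inv, Pi.add_apply, Pi.sub_apply, Pi.smul_apply,
          smul_eq_mul]
        rcases eq_or_ne j l with rfl | hjl
        · simp [hil.symm]
          field_simp
          ring
        rcases eq_or_ne j i with rfl | hji
        · simp [hil]
          field_simp
          ring
        · simp [hjl, hji, Equiv.swap_apply_of_ne_of_ne hjl hji]
          ring
      change toReal _ ∈ C
      rw [key]
      exact add_mem (C.smul_mem (sub_nonneg.2 (inv_le_one_of_one_le₀ hd1)) hwC)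
        (C.smul_mem (by positivity) hsw)
    · have h : ∑ j ∈ range n, (w - Pi.single l 1 + Pi.single i 1 : ℕ → ℤ) j = ∑ j ∈ range n, w j := by
        simp only [Pi.add_apply, Pi.sub_apply, sum_add_distrib, sum_sub_distrib]
        simp [Pi.single_apply, hi, hl]
      rw [h]
      exact hw.2

/-! ### Unbalancing transfers inside the cone -/

/-- Moving along finitely many directions inside a cone, with total weight at most one. -/
theorem add_sum_smul_mem {ι : Type*} {C : PointedCone ℝ (ℕ → ℝ)} {b : ℕ → ℝ} (hb : b ∈ C)
    {s : Finset ι} {t : ι → ℝ} {d : ι → ℕ → ℝ} (ht : ∀ h ∈ s, 0 ≤ t h) (ht1 : ∑ h ∈ s, t h ≤ 1)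
    (hd : ∀ h ∈ s, b + d h ∈ C) : b + ∑ h ∈ s, t h • d h ∈ C := by
  have h : b + ∑ h ∈ s, t h • d h = (1 - ∑ h ∈ s, t h) • b + ∑ h ∈ s, t h • (b + d h) := by
    simp only [smul_add, sum_add_distrib, sub_smul, one_smul, ← sum_smul]
    abel
  rw [h]
  exact add_mem (C.smul_mem (sub_nonneg.2 ht1) hb) (sum_smul_mem ht hd)

/-- Moving a whole coordinate to a vacant place. -/
theorem add_smul_single_sub_single_mem {n : ℕ} {C : PointedCone ℝ (ℕ → ℝ)}
    (hperm : ∀ σ ∈ symGroup n, ∀ u ∈ C, permAct σ u ∈ C) {i j : ℕ} (hi : i < n) (hj : j < n)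
    {b : ℕ → ℝ} (hb : b ∈ C) (hbj : b j = 0) :
    b + b i • (Pi.single j 1 - Pi.single i 1) ∈ C := by
  rcases eq_or_ne i j with rfl | hij
  · simpa using hb
  have h : b + b i • (Pi.single j 1 - Pi.single i 1) = permAct (Equiv.swap i j) b := by
    funext k
    simp only [permAct, Equiv.swap_inv, Pi.add_apply, Pi.sub_apply, Pi.smul_apply, smul_eq_mul]
    rcases eq_or_ne k i with rfl | hki
    · simp [hij, hbj]
    rcases eq_or_ne k j with rfl | hkj
    · simp [hij.symm, hbj]
    · simp [hki, hkj, Equiv.swap_apply_of_ne_of_ne hki hkj]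
  rw [h]
  exact hperm _ (swap_mem_symGroup hi hj) _ hb

/-- For `u = ∑ c_k b_k`, many coordinates `u_h` are carried for at least one half by those `b_k` that
vanish at both `i` and `l`. -/
theorem card_filter_capacity {ι : Type*} [Fintype ι] {n K : ℕ} {c : ι → ℝ} {b : ι → ℕ → ℝ}
    (hc : ∀ k, 0 ≤ c k) (hb0 : ∀ k h, 0 ≤ b k h) (hb1 : ∀ k h, 0 < b k h → 1 ≤ b k h)
    (hbK : ∀ k, ∑ h ∈ range n, b k h ≤ K) {u : ℕ → ℝ} (hu : ∀ h, u h = ∑ k, c k * b k h)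
    {i l : ℕ} (hui : 1 ≤ u i) (hul : u i ≤ u l) {H : Finset ℕ} (hH : ∀ h ∈ H, h < n ∧ u l ≤ u h)
    (hcard : 7 * K + 1 ≤ #H) :
    3 * K + 1 ≤ #{h ∈ H | u h ≤ 2 * ∑ k, if b k i = 0 ∧ b k l = 0 then c k * b k h else 0} := by
  set cap : ℕ → ℝ := fun h => ∑ k, if b k i = 0 ∧ b k l = 0 then c k * b k h else 0 with hcap
  have hterm : ∀ k h, c k * b k h - (if b k i = 0 ∧ b k l = 0 then c k * b k h else 0) ≤
      c k * (b k i + b k l) * b k h := by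
    intro k h
    have h0 : 0 ≤ c k * b k h := mul_nonneg (hc k) (hb0 k h)
    split_ifs with hk
    · simp [hk.1, hk.2]
    · have h1 : 1 ≤ b k i + b k l := by
        by_cases hki : b k i = 0
        · have := hb1 k l (lt_of_le_of_ne (hb0 k l) fun h => hk ⟨hki, h.symm⟩)
          linarith [hb0 k i]
        · have := hb1 k i (lt_of_le_of_ne (hb0 k i) fun h => hki h.symm)
          linarith [hb0 k l]
      nlinarith
  have hnonneg : ∀ h, 0 ≤ u h - cap h := by
    intro h
    rw [hu, hcap, ← sum_sub_distrib]
    refine sum_nonneg fun k _ => ?_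
    have h0 : 0 ≤ c k * b k h := mul_nonneg (hc k) (hb0 k h)
    split_ifs <;> linarith
  -- The mass outside the capacities sits on generators meeting `i` or `l`. Their total weight is at
  -- most `u i + u l`, and each has coordinate sum at most `K`.
  have htotal : ∑ h ∈ range n, (u h - cap h) ≤ 2 * K * u l := by
    calc ∑ h ∈ range n, (u h - cap h)
        ≤ ∑ h ∈ range n, ∑ k, c k * (b k i + b k l) * b k h := by
          refine sum_le_sum fun h _ => ?_
          rw [hu, hcap, ← sum_sub_distrib]
          exact sum_le_sum fun k _ => hterm k h
      _ = ∑ k, c k * (b k i + b k l) * ∑ h ∈ range n, b k h := by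
          rw [sum_comm]
          simp only [mul_sum]
      _ ≤ ∑ k, c k * (b k i + b k l) * K :=
          sum_le_sum fun k _ => mul_le_mul_of_nonneg_left (hbK k)
            (mul_nonneg (hc k) (add_nonneg (hb0 k i) (hb0 k l)))
      _ = (u i + u l) * K := by
          rw [← sum_mul, hu i, hu l, ← sum_add_distrib]
          simp only [mul_add]
      _ ≤ 2 * K * u l := by nlinarith [(Nat.cast_nonneg K : (0 : ℝ) ≤ K)]
  -- Each bad place loses more than `u l / 2` out of at most `2 * K * u l`.
  have hbad : #{h ∈ H | ¬ u h ≤ 2 * cap h} ≤ 4 * K := by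
    have h1 : #{h ∈ H | ¬ u h ≤ 2 * cap h} • (u l / 2) ≤
        ∑ h ∈ H with ¬ u h ≤ 2 * cap h, (u h - cap h) := by
      refine card_nsmul_le_sum _ _ _ fun h hh => ?_
      obtain ⟨hhH, hh⟩ := mem_filter.1 hh
      have := (hH h hhH).2
      linarith
    have h2 : ∑ h ∈ H with ¬ u h ≤ 2 * cap h, (u h - cap h) ≤ ∑ h ∈ range n, (u h - cap h) :=
      sum_le_sum_of_subset_of_nonneg
        (fun h hh => mem_range.2 (hH h (mem_filter.1 hh).1).1) fun h _ _ => hnonneg h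
    rw [nsmul_eq_mul] at h1
    have h3 : (#{h ∈ H | ¬ u h ≤ 2 * cap h} : ℝ) ≤ 4 * K := by
      have : 0 < u l := by linarith
      nlinarith
    exact_mod_cast h3
  have := card_filter_add_card_filter_not (s := H) (fun h => u h ≤ 2 * cap h)
  change 3 * K + 1 ≤ #{h ∈ H | u h ≤ 2 * cap h}
  omega

/-- Each nonzero entry contributes at least `1` to the sum. Thus every generator leaves most of a
large set of places vacant. -/
theorem card_filter_ne_zero_le {n K : ℕ} {b : ℕ → ℝ} (hb0 : ∀ h, 0 ≤ b h)
    (hb1 : ∀ h, 0 < b h → 1 ≤ b h) (hbK : ∑ h ∈ range n, b h ≤ K) {G : Finset ℕ}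
    (hG : ∀ h ∈ G, h < n) : #{h ∈ G | b h ≠ 0} ≤ K := by
  have h1 : #{h ∈ G | b h ≠ 0} • (1 : ℝ) ≤ ∑ h ∈ G with b h ≠ 0, b h :=
    card_nsmul_le_sum _ _ _ fun h hh =>
      hb1 h (lt_of_le_of_ne (hb0 h) (mem_filter.1 hh).2.symm)
  have h2 : ∑ h ∈ G with b h ≠ 0, b h ≤ ∑ h ∈ range n, b h :=
    sum_le_sum_of_subset_of_nonneg (fun h hh => mem_range.2 (hG h (mem_filter.1 hh).1))
      fun h _ _ => hb0 h
  have h3 : (#{h ∈ G | b h ≠ 0} : ℝ) ≤ K := by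
    rw [nsmul_eq_mul, mul_one] at h1
    linarith
  exact_mod_cast h3

/-- In a symmetric cone whose generators have coordinate sum at most `K` and no positive coordinate
smaller than `1`, a unit can be moved from a smallest positive coordinate to a second smallest one,
if there are many positive coordinates. -/
theorem sub_single_add_single_mem {ι : Type*} [Fintype ι] {n K : ℕ} {C : PointedCone ℝ (ℕ → ℝ)}
    (hperm : ∀ σ ∈ symGroup n, ∀ u ∈ C, permAct σ u ∈ C) {c : ι → ℝ} {b : ι → ℕ → ℝ}
    (hbC : ∀ k, b k ∈ C)
    (hc : ∀ k, 0 ≤ c k) (hb0 : ∀ k h, 0 ≤ b k h) (hb1 : ∀ k h, 0 < b k h → 1 ≤ b k h)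
    (hbK : ∀ k, ∑ h ∈ range n, b k h ≤ K) {u : ℕ → ℝ} (hu : u = ∑ k, c k • b k)
    {i l : ℕ} (hi : i < n) (hl : l < n) (hui : 1 ≤ u i) (hul : u i ≤ u l) {H : Finset ℕ}
    (hH : ∀ h ∈ H, h < n ∧ u l ≤ u h) (hcard : 7 * K + 1 ≤ #H) :
    u - Pi.single i 1 + Pi.single l 1 ∈ C := by
  have hu' : ∀ h, u h = ∑ k, c k * b k h := fun h => by
    rw [hu, Finset.sum_apply]
    simp
  set cap : ℕ → ℝ := fun h => ∑ k, if b k i = 0 ∧ b k l = 0 then c k * b k h else 0 with hcap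
  set G := {h ∈ H | u h ≤ 2 * cap h} with hG
  have hGcard : 3 * K + 1 ≤ #G := card_filter_capacity hc hb0 hb1 hbK hu' hui hul hH hcard
  have hGn : ∀ h ∈ G, h < n := fun h hh => (hH h (mem_filter.1 hh).1).1
  have hGcap : ∀ h ∈ G, 1 / 2 ≤ cap h := fun h hh => by
    have h1 := (mem_filter.1 hh).2
    have h2 := (hH h (mem_filter.1 hh).1).2
    linarith
  have hsupp : ∀ k, #{h ∈ G | b k h ≠ 0} ≤ K := fun k =>
    card_filter_ne_zero_le (hb0 k) (hb1 k) (hbK k) hGn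
  -- A generator using `i` may also use `l`, which blocks a direct move. The unit therefore detours:
  -- from `i` to places of `G` vacant in the generator, then from `G` to `l` by generators avoiding
  -- both `i` and `l`.
  set E : ι → Finset ℕ := fun k => {h ∈ G | b k h = 0} with hE
  have hEcard : ∀ k, 2 * K + 1 ≤ #(E k) := fun k => by
    have h1 := card_filter_add_card_filter_not (s := G) (fun h => b k h = 0)
    have h2 := hsupp k
    simp only [hE]
    simp only [ne_eq] at h2
    omega
  have hEpos : ∀ k, (0 : ℝ) < #(E k) := fun k => by
    have := hEcard k
    exact_mod_cast (by omega : 0 < #(E k))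
  have hu0 : 0 < u i := by linarith
  -- The amount reaching `h` when each generator spreads a fraction `1 / u i` of its entry at `i`
  -- evenly over its vacant places `E k`.
  set δ : ℕ → ℝ := fun h => ∑ k, if b k h = 0 then c k * b k i / (u i * #(E k)) else 0 with hδ
  have hδ0 : ∀ h, 0 ≤ δ h := fun h => sum_nonneg fun k _ => by
    split_ifs
    · exact div_nonneg (mul_nonneg (hc k) (hb0 k i)) (mul_nonneg hu0.le (hEpos k).le)
    · exact le_rfl
  have hδ1 : ∑ h ∈ G, δ h = 1 := by
    rw [hδ, sum_comm]
    have : ∀ k, ∑ h ∈ G, (if b k h = 0 then c k * b k i / (u i * #(E k)) else 0) =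
        c k * b k i / u i := fun k => by
      rw [← sum_filter, sum_const, nsmul_eq_mul]
      have := (hEpos k).ne'
      field_simp
      simp only [hE]
      ring
    simp only [this]
    rw [← sum_div, ← hu' i, div_self hu0.ne']
  have hδle : ∀ h, δ h * (2 * K + 1) ≤ 1 := fun h => by
    have h1 : δ h ≤ ∑ k, c k * b k i / (u i * (2 * K + 1)) := by
      refine sum_le_sum fun k _ => ?_
      have h2 : 0 ≤ c k * b k i := mul_nonneg (hc k) (hb0 k i)
      have h3 : (2 * K + 1 : ℝ) ≤ #(E k) := by exact_mod_cast hEcard k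
      split_ifs
      · gcongr
      · positivity
    rw [← sum_div, ← hu' i] at h1
    have h2 : u i / (u i * (2 * K + 1)) * (2 * K + 1) = 1 := by
      field_simp
    calc δ h * (2 * K + 1) ≤ u i / (u i * (2 * K + 1)) * (2 * K + 1) := by gcongr
      _ = 1 := h2
  -- The fraction of the capacity at `h` needed to send `δ h` on to `l`. It is at most `2 / (2 * K +
  -- 1)`, and a generator meets at most `K` places of `G`, so its total weight stays below `1`.
  set θ : ℕ → ℝ := fun h => δ h / cap h with hθ
  have hθ0 : ∀ h ∈ G, 0 ≤ θ h := fun h hh => div_nonneg (hδ0 h) (by linarith [hGcap h hh])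
  have hθle : ∀ h ∈ G, θ h * (2 * K + 1) ≤ 2 := fun h hh => by
    have h1 := hGcap h hh
    have h2 : 0 < cap h := by linarith
    rw [hθ, div_mul_eq_mul_div, div_le_iff₀ h2]
    linarith [hδle h]
  have hstep : ∀ k, b k +
      ((b k i / (u i * #(E k))) • ∑ h ∈ E k, (Pi.single h 1 - Pi.single i 1) +
        if b k i = 0 ∧ b k l = 0 then
          ∑ h ∈ G, (θ h * b k h) • (Pi.single l 1 - Pi.single h 1) else 0) ∈ C := by
    intro k
    -- The two legs never compete for the same generator: those carrying the second leg vanish at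
    -- `i` and contribute nothing to the first.
    by_cases hk : b k i = 0 ∧ b k l = 0
    · rw [if_pos hk, hk.1, zero_div, zero_smul, zero_add]
      have h1 : ∑ h ∈ G, (θ h * b k h) • (Pi.single l 1 - Pi.single h 1 : ℕ → ℝ) =
          ∑ h ∈ G with b k h ≠ 0, θ h • (b k h • (Pi.single l 1 - Pi.single h 1)) := by
        conv_rhs => rw [sum_filter]
        refine sum_congr rfl fun h _ => ?_
        split_ifs with h0
        · rw [mul_smul]
        · simp [not_not.1 h0]
      rw [h1]
      refine add_sum_smul_mem (hbC k) (fun h hh => hθ0 h (mem_filter.1 hh).1) ?_ fun h hh =>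
        add_smul_single_sub_single_mem hperm (hGn h (mem_filter.1 hh).1) hl (hbC k) hk.2
      have h2 : ∑ h ∈ G with b k h ≠ 0, θ h ≤ #{h ∈ G | b k h ≠ 0} • (2 / (2 * K + 1) : ℝ) :=
        sum_le_card_nsmul _ _ _ fun h hh => by
          rw [le_div_iff₀ (by positivity)]
          exact hθle h (mem_filter.1 hh).1
      have h3 : (#{h ∈ G | b k h ≠ 0} : ℝ) ≤ K := by exact_mod_cast hsupp k
      refine h2.trans ?_
      rw [nsmul_eq_mul, mul_div_assoc', div_le_one (by positivity)]
      linarith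
    · rw [if_neg hk, add_zero]
      have h1 : (b k i / (u i * #(E k))) • ∑ h ∈ E k, (Pi.single h 1 - Pi.single i 1 : ℕ → ℝ) =
          ∑ h ∈ E k, (1 / (u i * #(E k))) • (b k i • (Pi.single h 1 - Pi.single i 1)) := by
        rw [smul_sum]
        refine sum_congr rfl fun h _ => ?_
        rw [smul_smul]
        congr 1
        ring
      rw [h1]
      refine add_sum_smul_mem (hbC k) (fun h _ => ?_) ?_ fun h hh =>
        add_smul_single_sub_single_mem hperm hi (hGn h (mem_filter.1 hh).1) (hbC k)
          (mem_filter.1 hh).2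
      · have := hEpos k
        positivity
      · rw [sum_const, nsmul_eq_mul]
        have := hEpos k
        rw [mul_one_div, div_le_one (by positivity)]
        nlinarith
  have hmem := sum_smul_mem (s := univ) (fun k _ => hc k) fun k _ => hstep k
  convert hmem using 1
  have hfirst : ∑ k, c k • ((b k i / (u i * #(E k))) •
      ∑ h ∈ E k, (Pi.single h 1 - Pi.single i 1 : ℕ → ℝ)) =
      ∑ h ∈ G, δ h • (Pi.single h 1 - Pi.single i 1) := by
    simp only [hδ, sum_smul]
    rw [sum_comm]
    refine sum_congr rfl fun k _ => ?_
    rw [smul_smul, smul_sum, hE, sum_filter]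
    refine sum_congr rfl fun h _ => ?_
    split_ifs
    · rw [mul_div_assoc]
    · rw [zero_smul]
  have hsecond : ∑ k, c k • (if b k i = 0 ∧ b k l = 0 then
      ∑ h ∈ G, (θ h * b k h) • (Pi.single l 1 - Pi.single h 1 : ℕ → ℝ) else 0) =
      ∑ h ∈ G, δ h • (Pi.single l 1 - Pi.single h 1) := by
    have h1 : ∀ h ∈ G, δ h • (Pi.single l 1 - Pi.single h 1 : ℕ → ℝ) =
        ∑ k, (if b k i = 0 ∧ b k l = 0 then c k * (θ h * b k h) else 0) •
          (Pi.single l 1 - Pi.single h 1) := by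
      intro h hh
      rw [← sum_smul]
      congr 1
      have h2 : cap h ≠ 0 := by
        have := hGcap h hh
        linarith
      calc δ h = θ h * cap h := (div_mul_cancel₀ _ h2).symm
        _ = _ := by
          simp only [hcap, mul_sum, mul_ite, mul_zero]
          refine sum_congr rfl fun k _ => ?_
          split_ifs
          · ring
          · rfl
    rw [sum_congr rfl h1, sum_comm]
    refine sum_congr rfl fun k _ => ?_
    split_ifs
    · rw [smul_sum]
      simp only [smul_smul]
    · simp
  simp only [smul_add, sum_add_distrib]
  rw [hfirst, hsecond, ← hu, ← sum_add_distrib]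
  simp only [← smul_add]
  -- Inflow and outflow at each intermediate place cancel.
  have h3 : ∀ h, (Pi.single h 1 - Pi.single i 1 + (Pi.single l 1 - Pi.single h 1) : ℕ → ℝ) =
      Pi.single l 1 - Pi.single i 1 := fun h => by abel
  simp only [h3]
  rw [← sum_smul, hδ1, one_smul]
  abel

/-! ### Transfers on integer points and induction on the sum of squares -/

theorem sum_permAct {R : Type*} [AddCommMonoid R] {n : ℕ} {σ : Equiv.Perm ℕ}
    (hσ : σ ∈ symGroup n) (u : ℕ → R) :
    ∑ i ∈ range n, permAct σ u i = ∑ i ∈ range n, u i := by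
  have hσ' := (symGroup n).inv_mem hσ
  refine sum_equiv σ⁻¹ (fun i => ?_) fun _ _ => rfl
  rw [mem_range, mem_range]
  refine ⟨symGroup_apply_lt hσ', fun h => ?_⟩
  have := symGroup_apply_lt hσ h
  rwa [perm_apply_inv_self] at this

theorem toReal_mem_coordSubspace {n : ℕ} {u : ℕ → ℤ} :
    toReal u ∈ coordSubspace ℝ n ↔ u ∈ coordSubspace ℤ n :=
  forall₂_congr fun _ _ => Int.cast_eq_zero

/-- An integer point with many positive coordinates of a symmetric cone with integral generators
can be made less balanced without leaving the cone. -/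
theorem exists_transfer_mem_latticePoints {n K : ℕ} {A : Set (ℕ → ℤ)} {C : PointedCone ℝ (ℕ → ℝ)}
    (hperm : ∀ σ ∈ symGroup n, ∀ u ∈ C, permAct σ u ∈ C) (hnonneg : ∀ u ∈ C, ∀ i, 0 ≤ u i)
    (hAK : ∀ a ∈ A, ∑ h ∈ range n, a h ≤ K)
    (hC : C = PointedCone.hull ℝ (symOrbit n (toReal '' A))) {u : ℕ → ℤ}
    (hu : u ∈ latticePoints n C) (hcard : 7 * K + 3 ≤ #{h ∈ range n | u h ≠ 0}) :
    ∃ i l, i < n ∧ l < n ∧ i ≠ l ∧ u i ≤ u l ∧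
      u - Pi.single i 1 + Pi.single l 1 ∈ latticePoints n C := by
  set S := {h ∈ range n | u h ≠ 0} with hS
  obtain ⟨i, hiS, hi⟩ := S.exists_min_image u (card_pos.1 (by omega))
  have hcard' := card_erase_of_mem hiS
  obtain ⟨l, hlS, hl⟩ := (S.erase i).exists_min_image u (card_pos.1 (by omega))
  have hcard'' := card_erase_of_mem hlS
  have hin : i < n := mem_range.1 (mem_filter.1 hiS).1
  have hlS' := mem_of_mem_erase hlS
  have hln : l < n := mem_range.1 (mem_filter.1 hlS').1
  have hil : i ≠ l := (ne_of_mem_erase hlS).symm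
  refine ⟨i, l, hin, hln, hil, hi l hlS', ⟨fun j hj => ?_, ?_⟩⟩
  · have h1 : j ≠ l := by omega
    have h2 : j ≠ i := by omega
    simp [h1, h2, hu.1 j hj]
  have hu' : toReal u ∈ PointedCone.hull ℝ (symOrbit n (toReal '' A)) := hC ▸ hu.2
  obtain ⟨N, c, b, hc, hb, hub⟩ := exists_sum_of_mem_hull hu'
  have hbC : ∀ k, b k ∈ C := fun k => by
    rw [hC]
    exact PointedCone.subset_hull (hb k)
  have hb' : ∀ k, ∃ σ ∈ symGroup n, ∃ a ∈ A, b k = toReal (permAct σ a) := fun k => by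
    obtain ⟨σ, hσ, _, ⟨a, ha, rfl⟩, h⟩ := hb k
    exact ⟨σ, hσ, a, ha, h⟩
  choose σ hσ a ha hba using hb'
  have hui : 1 ≤ u i := by
    have h1 : 0 ≤ u i := by exact_mod_cast hnonneg _ hu.2 i
    have h2 := (mem_filter.1 hiS).2
    omega
  -- Erasing `i` and `l` from the support leaves `7 * K + 1` places, all with entries at least `u
  -- l`.
  have key := sub_single_add_single_mem (K := K) (H := (S.erase i).erase l) hperm hbC hc
    (fun k => hnonneg _ (hbC k)) (fun k h hpos => ?_) (fun k => ?_) hub hin hln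
    (Int.cast_one_le_of_pos hui) (Int.cast_le.2 (hi l hlS')) (fun h hh => ⟨?_, ?_⟩) (by omega)
  · convert key using 1
    funext j
    simp [toReal, Pi.single_apply]
  · rw [hba] at hpos ⊢
    have h1 : 0 < permAct (σ k) (a k) h := Int.cast_pos.1 hpos
    exact Int.cast_one_le_of_pos h1
  · rw [hba]
    have h1 := hAK _ (ha k)
    rw [← sum_permAct (hσ k)] at h1
    simp only [toReal]
    exact_mod_cast h1
  · exact mem_range.1 (mem_filter.1 (mem_of_mem_erase (mem_of_mem_erase hh))).1
  · exact Int.cast_le.2 (hl h (mem_of_mem_erase hh))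

theorem sum_sub_single_add_single {n i l : ℕ} (hi : i < n) (hl : l < n) (u : ℕ → ℤ) :
    ∑ j ∈ range n, (u - Pi.single i 1 + Pi.single l 1 : ℕ → ℤ) j = ∑ j ∈ range n, u j := by
  simp only [Pi.add_apply, Pi.sub_apply, sum_add_distrib, sum_sub_distrib]
  simp [Pi.single_apply, hi, hl]

/-- When `u i ≤ u l` the sum of squares grows by at least `2`, which makes the unbalancing process
terminate. -/
theorem sum_sq_sub_single_add_single {n i l : ℕ} (hi : i < n) (hl : l < n) (hil : i ≠ l)
    (u : ℕ → ℤ) :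
    ∑ j ∈ range n, (u - Pi.single i 1 + Pi.single l 1 : ℕ → ℤ) j ^ 2 =
      ∑ j ∈ range n, u j ^ 2 + 2 * (u l - u i) + 2 := by
  have h : ∀ j, (u - Pi.single i 1 + Pi.single l 1 : ℕ → ℤ) j ^ 2 =
      u j ^ 2 + (if j = i then 1 - 2 * u i else 0) + (if j = l then 1 + 2 * u l else 0) := by
    intro j
    rcases eq_or_ne j i with rfl | hji
    · simp [hil]
      ring
    rcases eq_or_ne j l with rfl | hjl
    · simp [hji]
      ring
    · simp [hji, hjl]
  simp only [h, sum_add_distrib, sum_ite_eq', mem_range, hi, hl, if_true]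
  ring

/-- If every point with many positive coordinates can be made less balanced and all others are sums
of points of coordinate sum at most `K`, then all points are. -/
theorem mem_closure_of_transfer {n K R : ℕ} {C : PointedCone ℝ (ℕ → ℝ)}
    (hperm : ∀ σ ∈ symGroup n, ∀ u ∈ C, permAct σ u ∈ C) (hnonneg : ∀ u ∈ C, ∀ i, 0 ≤ u i)
    (htransfer : ∀ u ∈ latticePoints n C, R ≤ #{h ∈ range n | u h ≠ 0} →
      ∃ i l, i < n ∧ l < n ∧ i ≠ l ∧ u i ≤ u l ∧
        u - Pi.single i 1 + Pi.single l 1 ∈ latticePoints n C)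
    (hbase : ∀ u ∈ latticePoints n C, #{h ∈ range n | u h ≠ 0} < R →
      u ∈ AddSubmonoid.closure {w | w ∈ latticePoints n C ∧ ∑ j ∈ range n, w j ≤ K})
    {u : ℕ → ℤ} (hu : u ∈ latticePoints n C) :
    u ∈ AddSubmonoid.closure {w | w ∈ latticePoints n C ∧ ∑ j ∈ range n, w j ≤ K} := by
  have hsq : ∀ v ∈ latticePoints n C,
      ∑ j ∈ range n, v j ^ 2 ≤ (∑ j ∈ range n, v j) ^ 2 := fun v hv => by
    have h0 : ∀ j, 0 ≤ v j := fun j => by exact_mod_cast hnonneg _ hv.2 j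
    rw [sq, sum_mul]
    refine sum_le_sum fun j hj => ?_
    rw [sq]
    exact mul_le_mul_of_nonneg_left (single_le_sum (fun k _ => h0 k) hj) (h0 j)
  -- By `hsq` this difference is nonnegative before truncation, so each transfer strictly decreases
  -- it.
  induction hd : ((∑ j ∈ range n, u j) ^ 2 - ∑ j ∈ range n, u j ^ 2).toNat using
    Nat.strong_induction_on generalizing u with
  | _ d ih =>
    rcases lt_or_ge #{h ∈ range n | u h ≠ 0} R with hR | hR
    · exact hbase u hu hR
    obtain ⟨i, l, hi, hl, hil, hul, hmem⟩ := htransfer u hu hR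
    set v : ℕ → ℤ := u - Pi.single i 1 + Pi.single l 1 with hv
    have h1 : ∑ j ∈ range n, v j = ∑ j ∈ range n, u j := sum_sub_single_add_single hi hl u
    have h2 : ∑ j ∈ range n, v j ^ 2 = ∑ j ∈ range n, u j ^ 2 + 2 * (u l - u i) + 2 :=
      sum_sq_sub_single_add_single hi hl hil u
    have h3 := hsq v hmem
    have h4 := ih _ (by rw [← hd, h2, h1] at *; omega) hmem rfl
    have h5 := transfer_mem_closure hperm hi hl h4 (by
      simp [hv, hil, hil.symm]
      omega)
    convert h5 using 1
    rw [hv]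
    abel

theorem card_support_le_sum {n : ℕ} {w : ℕ → ℤ} (hw : ∀ i, 0 ≤ w i) :
    (#{h ∈ range n | w h ≠ 0} : ℤ) ≤ ∑ j ∈ range n, w j := by
  have h1 : #{h ∈ range n | w h ≠ 0} • (1 : ℤ) ≤ ∑ h ∈ range n with w h ≠ 0, w h :=
    card_nsmul_le_sum _ _ _ fun h hh => by
      have h1 := (mem_filter.1 hh).2
      have h2 := hw h
      omega
  have h2 : ∑ h ∈ range n with w h ≠ 0, w h ≤ ∑ j ∈ range n, w j :=
    sum_le_sum_of_subset_of_nonneg (filter_subset _ _) fun h _ _ => hw h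
  simp only [mul_one, nsmul_eq_mul] at h1
  exact h1.trans h2

theorem sum_range_eq_of_mem_coordSubspace {m n : ℕ} (hmn : m ≤ n) {w : ℕ → ℤ}
    (hw : w ∈ coordSubspace ℤ m) : ∑ j ∈ range n, w j = ∑ j ∈ range m, w j :=
  (sum_subset (range_subset_range.2 hmn) fun j _ hj => hw j (by simpa using hj)).symm

/-! ### The chain of monoids: invariance and stabilization -/

section Chain

variable {C : ℕ → PointedCone ℝ (ℕ → ℝ)}

theorem isSymInvariantMonoidChain_latticePoints (hchain : IsSymInvariantConeChain C) :
    IsSymInvariantMonoidChain fun n => latticePoints n (C n) where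
  subset_coord _ _ _ hu := hu.1
  invariant m n hm hmn := by
    refine (AddSubmonoid.closure_le).2 ?_
    rintro _ ⟨σ, hσ, u, hu, rfl⟩
    exact ⟨permAct_mem_coordSubspace hσ (coordSubspace_mono hmn hu.1),
      hchain.permAct_mem hm hmn hσ hu.2⟩

/-- If `C_n` is generated by the orbit of `C_r` and `C_r` is generated by `A`, then `C_n` is
generated by the orbit of `A`. -/
theorem eq_hull_symOrbit (hchain : IsSymInvariantConeChain C) {r n : ℕ} (hr : 1 ≤ r) (hrn : r ≤ n)
    (hn : C n = PointedCone.hull ℝ (symOrbit n (C r : Set (ℕ → ℝ)))) {A : Set (ℕ → ℝ)}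
    (hA : C r = PointedCone.hull ℝ A) : C n = PointedCone.hull ℝ (symOrbit n A) := by
  refine le_antisymm ?_ ?_
  · rw [hn]
    refine Submodule.span_le.2 ?_
    rintro _ ⟨σ, hσ, u, hu, rfl⟩
    rw [SetLike.mem_coe, hA] at hu
    obtain ⟨N, c, b, hc, hb, rfl⟩ := exists_sum_of_mem_hull hu
    have h : permAct σ (∑ k, c k • b k) = ∑ k, c k • permAct σ (b k) := by
      funext i
      simp [permAct, Finset.sum_apply]
    rw [h]
    exact sum_smul_mem (fun k _ => hc k) fun k _ =>
      PointedCone.subset_hull ⟨σ, hσ, b k, hb k, rfl⟩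
  · refine Submodule.span_le.2 ?_
    rintro _ ⟨σ, hσ, u, hu, rfl⟩
    refine hchain.permAct_mem hr hrn hσ ?_
    rw [hA]
    exact PointedCone.subset_hull hu

theorem monoidChainStabilizes_latticePoints (hchain : IsSymInvariantConeChain C)
    (hstab : ConeChainStabilizes C) (hfg : ∀ n, 1 ≤ n → (C n).FG)
    (hrat : ∀ n, 1 ≤ n → IsRationalCone (C n))
    (hnonneg : ∀ n, 1 ≤ n → ∀ u ∈ C n, ∀ i, 0 ≤ u i) :
    MonoidChainStabilizes fun n => latticePoints n (C n) := by
  obtain ⟨r, hr, hstab⟩ := hstab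
  obtain ⟨A, hA⟩ := exists_integral_generators (hchain.subset_coord r hr) (hfg r hr) (hrat r hr)
  have hAr : ∀ a ∈ A, toReal a ∈ C r := fun a ha => by
    rw [hA]
    exact PointedCone.subset_hull ⟨a, ha, rfl⟩
  have hAcoord : ∀ a ∈ A, a ∈ coordSubspace ℤ r := fun a ha =>
    toReal_mem_coordSubspace.1 (hchain.subset_coord r hr (hAr a ha))
  obtain ⟨K, hK⟩ : ∃ K : ℕ, ∀ a ∈ A, ∑ h ∈ range r, a h ≤ K :=
    ⟨A.sup fun a => (∑ h ∈ range r, a h).toNat, fun a ha => (Int.self_le_toNat _).trans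
      (by exact_mod_cast le_sup (f := fun a : ℕ → ℤ => (∑ h ∈ range r, a h).toNat) ha)⟩
  -- Beyond `r` the cones are orbit-generated, and points with fewer than `7 * K + 3` nonzero
  -- entries fit into `[R]`.
  set R := max r (7 * K + 3) with hR
  have hrR : r ≤ R := le_max_left _ _
  obtain ⟨F, hF⟩ := fg_latticePoints (hchain.subset_coord R (by omega)) (hfg R (by omega))
    (hrat R (by omega)) (hnonneg R (by omega))
  obtain ⟨K', hK'⟩ : ∃ K' : ℕ, ∀ a ∈ F, ∑ h ∈ range R, a h ≤ K' :=
    ⟨F.sup fun a => (∑ h ∈ range R, a h).toNat, fun a ha => (Int.self_le_toNat _).trans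
      (by exact_mod_cast le_sup (f := fun a : ℕ → ℤ => (∑ h ∈ range R, a h).toNat) ha)⟩
  have hFR : ∀ f ∈ F, f ∈ latticePoints R (C R) := fun f hf => by
    rw [← hF]
    exact AddSubmonoid.subset_closure hf
  have hinv := isSymInvariantMonoidChain_latticePoints hchain
  have hmove : ∀ m n, R ≤ m → m ≤ n → ∀ u ∈ latticePoints n (C n),
      #{h ∈ range n | u h ≠ 0} ≤ m →
      ∃ σ ∈ symGroup n, permAct σ u ∈ latticePoints m (C m) := by
    intro m n hm hmn u hu hcard
    obtain ⟨σ, hσ, h⟩ := exists_permAct_mem_coordSubspace hmn hu.1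
      (S := {h ∈ range n | u h ≠ 0}) (fun i hi => mem_filter.2 ⟨mem_range.2 (by
        by_contra! hni
        exact hi (hu.1 i hni)), hi⟩) hcard
    refine ⟨σ, hσ, h, ?_⟩
    exact mem_of_mem_coordSubspace hchain hnonneg hr (hrR.trans hm) hmn
      (hstab r n le_rfl (by omega)) (hchain.permAct_mem (by omega) le_rfl hσ hu.2)
      (toReal_mem_coordSubspace.2 h)
  have hgen : ∀ n, R ≤ n → ∀ u ∈ latticePoints n (C n), u ∈ AddSubmonoid.closure
      {w | w ∈ latticePoints n (C n) ∧ ∑ j ∈ range n, w j ≤ K'} := by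
    intro n hn u hu
    refine mem_closure_of_transfer (R := 7 * K + 3)
      (fun σ hσ u hu => hchain.permAct_mem (by omega) le_rfl hσ hu) (hnonneg n (by omega))
      (fun u hu hcard => ?_) (fun u hu hcard => ?_) hu
    · refine exists_transfer_mem_latticePoints (A := A)
        (fun σ hσ u hu => hchain.permAct_mem (by omega) le_rfl hσ hu) (hnonneg n (by omega))
        (fun a ha => ?_) (eq_hull_symOrbit hchain hr (by omega) (hstab r n le_rfl (by omega)) hA)
        hu hcard
      rw [sum_range_eq_of_mem_coordSubspace (by omega) (hAcoord a ha)]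
      exact hK a ha
    · obtain ⟨σ, hσ, h⟩ := hmove R n le_rfl hn u hu (by omega)
      have hσ' := (symGroup n).inv_mem hσ
      rw [← permAct_inv_permAct σ u]
      rw [← hF] at h
      generalize permAct σ u = v at h
      induction h using AddSubmonoid.closure_induction with
      | zero => exact zero_mem _
      | add x y _ _ hx hy =>
        rw [permAct_add]
        exact add_mem hx hy
      | mem f hf =>
        refine AddSubmonoid.subset_closure ⟨hinv.invariant R n (by omega) hn
          (AddSubmonoid.subset_closure ⟨σ⁻¹, hσ', f, hFR f hf, rfl⟩), ?_⟩
        rw [sum_permAct hσ', sum_range_eq_of_mem_coordSubspace hn (hFR f hf).1]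
        exact hK' f hf
  -- Generators of sum at most `K'` have at most `K'` nonzero entries, so they can be permuted into
  -- `[m]` as soon as `m ≥ K'`.
  refine ⟨max R K', by omega, fun m n hm hmn => le_antisymm (fun u hu => ?_)
    (hinv.invariant m n (by omega) hmn)⟩
  refine (AddSubmonoid.closure_le.2 ?_) (hgen n (by omega) u hu)
  rintro w ⟨hw, hwK⟩
  have h0 : ∀ i, 0 ≤ w i := fun i => by exact_mod_cast hnonneg n (by omega) _ hw.2 i
  have hcard := card_support_le_sum (n := n) h0
  obtain ⟨σ, hσ, h⟩ := hmove m n (by omega) hmn w hw (by omega)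
  exact AddSubmonoid.subset_closure
    ⟨σ⁻¹, (symGroup n).inv_mem hσ, permAct σ w, h, (permAct_inv_permAct σ w).symm⟩

end Chain

end SymGordan

theorem mainTheorem9 (C : ℕ → PointedCone ℝ (ℕ → ℝ))
    (hchain : SymGordan.IsSymInvariantConeChain C)
    (hstab : SymGordan.ConeChainStabilizes C)
    (hfg : ∀ n, 1 ≤ n → (C n).FG)
    (hrat : ∀ n, 1 ≤ n → SymGordan.IsRationalCone (C n))
    (hnonneg : ∀ n, 1 ≤ n → ∀ u ∈ C n, ∀ i, 0 ≤ u i) :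
    SymGordan.IsSymInvariantMonoidChain (fun n => SymGordan.latticePoints n (C n)) ∧
    SymGordan.MonoidChainStabilizes (fun n => SymGordan.latticePoints n (C n)) ∧
    (∀ n, 1 ≤ n → (SymGordan.latticePoints n (C n)).FG) ∧
    (∀ n, 1 ≤ n → SymGordan.IsNormalMonoid (SymGordan.latticePoints n (C n))) :=
  ⟨SymGordan.isSymInvariantMonoidChain_latticePoints hchain,
    SymGordan.monoidChainStabilizes_latticePoints hchain hstab hfg hrat hnonneg,
    fun n hn => SymGordan.fg_latticePoints (hchain.subset_coord n hn) (hfg n hn) (hrat n hn)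
      (hnonneg n hn),
    fun n _ => SymGordan.isNormalMonoid_latticePoints n (C n)⟩
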